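/- Let $(R,\mathfrak m)$ be a Cohen–Macaulay (Noetherian) local ring of dimension $d\ge 2$ with infinite residue field, and let $I$ be an $\mathfrak m$-primary ideal. Write $H_I(n)=\lambda(R/I^n)$ ($\lambda$ denotes length) for the Hilbert–Samuel function, and let $P_I\in\mathbb Q[X]$ be the Hilbert–Samuel polynomial, i.e. the (existing and unique) polynomial with $P_I(n)=H_I(n)$ for all $n\gg0$. For an ideal $J$ of a commutative ring let $\widetilde J=\bigcup_{n\ge1}(J^{n+1}:J^n)$ be its Ratliff–Rush closure, and put $\rho(I)=\min\{i\ge1:\widetilde{I^n}=I^n\text{ for all }n\ge i\}$. An element $x\in J$ is superficial for $J$ if there is an integer $c\ge1$ such that $(J^{n+1}:x)\cap J^c=J^n$ for all $n\ge c$; elements $x_1,\dots,x_s\in I$ form a superficial sequence for $I$ if, for each $i$, the image of $x_i$ in $R/(x_1,\dots,x_{i-1})$ is superficial for $I/(x_1,\dots,x_{i-1})$. The Ratliff–Rush filtration of $I$ behaves well mod $x_1,\dots,x_s$ if, with $R_s=R/(x_1,\dots,x_s)$ and $\pi:R\to R_s$ the quotient map, $\pi(\widetilde{I^n})=\widetilde{I^nR_s}$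 for all $n\ge1$. Let $x_1,\dots,x_{d-2}\in I$ be a superficial sequence for $I$ such that the Ratliff–Rush filtration of $I$ behaves well mod $x_1,\dots,x_{d-2}$. Then $$(-1)^{d-i}\,\Delta^i\bigl(P_I(n)-H_I(n)\bigr)\ge 0\qquad\text{for all }0\le i\le d\text{ and all }n\ge\rho(I),$$ where $\Delta f(n)=f(n+1)-f(n)$ and $\Delta^i$ is its $i$-th iterate. -/

import Mathlib

open Filter Polynomial IsLocalRing

/-- A Noetherian local ring is Cohen–Macaulay if its depth equals its Krull dimension, i.e. if
its maximal ideal contains a regular sequence whose length is the dimension of the ring. -/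
def IsCohenMacaulayLocal (R : Type*) [CommRing R] [IsLocalRing R] : Prop :=
  IsNoetherianRing R ∧ ∃ rs : List R, (∀ r ∈ rs, r ∈ maximalIdeal R) ∧
    RingTheory.Sequence.IsRegular R rs ∧ (rs.length : WithBot ℕ∞) = ringKrullDim R

section RatliffRush

variable {R : Type*} [CommRing R]

/-- The Ratliff–Rush closure `⋃_{n ≥ 1} (I ^ (n + 1) : I ^ n)` of an ideal `I`. The ideals
`I ^ (n + 1) : I ^ n` form an increasing chain, so that their supremum is their union
(see `mem_ratliffRush`). -/
def ratliffRush (I : Ideal R) : Ideal R :=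
  ⨆ n : {n : ℕ // 1 ≤ n}, (I ^ (n.1 + 1)).colon (I ^ n.1 : Ideal R)

theorem mem_ratliffRush (I : Ideal R) (a : R) :
    a ∈ ratliffRush I ↔ ∃ n : ℕ, 1 ≤ n ∧ ∀ b ∈ I ^ n, a * b ∈ I ^ (n + 1) := by
  have hmono : Monotone
      (fun n : {n : ℕ // 1 ≤ n} => (I ^ (n.1 + 1)).colon (I ^ n.1 : Ideal R)) := by
    rintro ⟨m, hm⟩ ⟨n, hn⟩ hmn a ha
    obtain ⟨k, rfl⟩ := Nat.exists_eq_add_of_le (show m ≤ n from hmn)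
    rw [Submodule.mem_colon] at ha ⊢
    intro b hb
    have hb' : b ∈ I ^ m * I ^ k := by rw [← pow_add]; exact hb
    have e : I ^ (m + k + 1) = I ^ (m + 1) * I ^ k := by rw [← pow_add]; congr 1; omega
    show a • b ∈ I ^ (m + k + 1)
    rw [e]
    refine Submodule.mul_induction_on hb' (fun u hu v hv => ?_) (fun u v hu hv => ?_)
    · rw [smul_eq_mul, ← mul_assoc]
      exact Ideal.mul_mem_mul (ha u hu) hv
    · rw [smul_add]
      exact add_mem hu hv
  have : Nonempty {n : ℕ // 1 ≤ n} := ⟨⟨1, le_rfl⟩⟩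
  rw [ratliffRush, Submodule.mem_iSup_of_directed _ hmono.directed_le]
  simp [Submodule.mem_colon]

/-- The stability index of the Ratliff–Rush filtration: the least `i ≥ 1` such that `I ^ n` is
Ratliff–Rush closed for all `n ≥ i`. -/
noncomputable def stabilityIndex (I : Ideal R) : ℕ :=
  sInf {i : ℕ | 1 ≤ i ∧ ∀ n ≥ i, ratliffRush (I ^ n) = I ^ n}

/-- `x ∈ I` is superficial for `I` if there is a positive integer `c` such that
`(I ^ (n + 1) : x) ∩ I ^ c = I ^ n` for all `n ≥ c`. -/
def IsSuperficial (I : Ideal R) (x : R) : Prop :=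
  x ∈ I ∧ ∃ c : ℕ, 1 ≤ c ∧ ∀ n ≥ c, (I ^ (n + 1)).colon {x} ⊓ I ^ c = I ^ n

/-- The ideal `(x_1, …, x_i)`, with the sequence indexed from `0`: it is generated by the
`x j` with `j < i`. -/
def initialIdeal {s : ℕ} (x : Fin s → R) (i : ℕ) : Ideal R :=
  Ideal.span {r | ∃ j : Fin s, (j : ℕ) < i ∧ x j = r}

/-- `x_1, …, x_s` is a superficial sequence for `I`: the elements lie in `I`, and the image of
each `x_i` in `R / (x_1, …, x_{i-1})` is superficial for `I / (x_1, …, x_{i-1})`. -/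
def IsSuperficialSequence (I : Ideal R) {s : ℕ} (x : Fin s → R) : Prop :=
  ∀ i : Fin s, x i ∈ I ∧
    IsSuperficial (I.map (Ideal.Quotient.mk (initialIdeal x i)))
      (Ideal.Quotient.mk (initialIdeal x i) (x i))

/-- The Ratliff–Rush filtration of `I` behaves well mod `x_1, …, x_s`: for all `n ≥ 1`, the image
of the Ratliff–Rush closure of `I ^ n` in `R_s = R / (x_1, …, x_s)` is the Ratliff–Rush closure of
`I ^ n R_s`. -/
def RatliffRushBehavesWell (I : Ideal R) {s : ℕ} (x : Fin s → R) : Prop :=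
  ∀ n : ℕ, 1 ≤ n →
    (ratliffRush (I ^ n)).map (Ideal.Quotient.mk (initialIdeal x s)) =
      ratliffRush ((I ^ n).map (Ideal.Quotient.mk (initialIdeal x s)))

end RatliffRush

section HilbertSamuel

variable {R : Type*} [CommRing R]

/-- The Hilbert–Samuel function `n ↦ λ(R / I ^ n)`; the length is finite if `R` is a Noetherian
local ring and `I` is primary to the maximal ideal. -/
noncomputable def hilbertSamuel (I : Ideal R) (n : ℕ) : ℕ :=
  (Module.length R (R ⧸ I ^ n)).toNat

/-- `P` takes the same values as the Hilbert–Samuel function of `I` at all large integers. -/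
def IsHilbertSamuelPoly (I : Ideal R) (P : ℚ[X]) : Prop :=
  ∀ᶠ n : ℕ in atTop, P.eval (n : ℚ) = (hilbertSamuel I n : ℚ)

/-- The Hilbert–Samuel polynomial of `I`: the polynomial with `IsHilbertSamuelPoly I P`, which is
unique by `IsHilbertSamuelPoly.eq` (with the value `0` if there is none). -/
noncomputable def hilbertSamuelPoly (I : Ideal R) : ℚ[X] :=
  open Classical in if h : ∃ P, IsHilbertSamuelPoly I P then h.choose else 0

theorem IsHilbertSamuelPoly.eq {I : Ideal R} {P : ℚ[X]} (h : IsHilbertSamuelPoly I P) :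
    hilbertSamuelPoly I = P := by
  have hex : ∃ P, IsHilbertSamuelPoly I P := ⟨P, h⟩
  rw [hilbertSamuelPoly, dif_pos hex]
  have h2 := hex.choose_spec
  obtain ⟨N, hN⟩ := eventually_atTop.1 (h.and h2)
  refine Polynomial.eq_of_infinite_eval_eq _ _
    (((Set.Ici_infinite N).image (Nat.cast_injective (R := ℚ)).injOn).mono ?_)
  rintro _ ⟨n, hn, rfl⟩
  exact (hN n hn).2.trans (hN n hn).1.symm

end HilbertSamuel

/-! Write `Fₙ` for the Ratliff–Rush closure of `Iⁿ`. From `ρ(I)` on, `H_I(n) = λ(R/Fₙ)`, so it is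
enough to bound the `d`-th difference of `λ(R/Fₙ)` by its eventual value `e`. Then `Δᵈ(P_I - H_I) ≥
0` from `ρ(I)` on, and since `P_I - H_I` is eventually zero, summing back from infinity flips the
sign at each lower order (`fwdDiff_iter_sub_alternating`).

For the bound, extend the sequence by two generic elements to `z_0, …, z_{d-1}`, which is
`R`-regular because `R` is Cohen–Macaulay. Good behaviour says that `F` induces a Ratliff–Rush
filtration modulo `z_0, …, z_{d-3}`, and `z_{d-2}` is regular on its graded ring. Sally descent
(`mem_of_mul_mem_of_sup_span`) lifts this: `z_0, …, z_{d-2}` is regular on the graded ring of `F`.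
With `K = (z_0, …, z_{d-2})` and `G_m = F_m + K`, the difference of order `d - 1` at `n` is thus
`λ(R/G_{n+d-1})`.

In the one-dimensional ring `R/K` the element `y = z_{d-1}` is regular, and `yG_m + K ⊆ G_{m+1}` has
colength `λ(R/G_m) + e` with `e = λ(R/(K + (y)))`. Hence the `d`-th difference is at most `e`, with
equality for large `m` because `y` generates a reduction. The eventual constancy also yields the
Hilbert–Samuel polynomial. -/

/-! ### Nonzerodivisors modulo an ideal. -/

section RegularModulo

variable {R : Type*} [CommRing R]

/-- `z` is a nonzerodivisor modulo the ideal `K`. -/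
def IsRegularMod (K : Ideal R) (z : R) : Prop :=
  ∀ a, z * a ∈ K → a ∈ K

theorem IsRegularMod.pow {K : Ideal R} {z : R} (h : IsRegularMod K z) (n : ℕ) :
    IsRegularMod K (z ^ n) := by
  induction n with
  | zero => intro a ha; simpa using ha
  | succ n ih =>
    intro a ha
    exact ih a (h _ (by rwa [pow_succ', mul_assoc] at ha))

/-- If `z` is regular modulo `K + (x)` and `x` is regular modulo `K`, then `x` is regular modulo
`K + (z)`. -/
theorem IsRegularMod.sup_span_swap {K : Ideal R} {x z : R} (hx : IsRegularMod K x)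
    (hzx : IsRegularMod (K ⊔ Ideal.span {x}) z) :
    IsRegularMod (K ⊔ Ideal.span {z}) x := by
  intro a ha
  obtain ⟨k, hk, w, hw, e⟩ := Submodule.mem_sup.1 ha
  obtain ⟨b, rfl⟩ := Ideal.mem_span_singleton'.1 hw
  have hb : b ∈ K ⊔ Ideal.span {x} := by
    apply hzx
    have : z * b = -k + a * x := by linear_combination e
    rw [this]
    exact add_mem (Ideal.mem_sup_left (neg_mem hk))
      (Ideal.mem_sup_right (Ideal.mem_span_singleton'.2 ⟨a, rfl⟩))
  obtain ⟨k', hk', v, hv, e'⟩ := Submodule.mem_sup.1 hb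
  obtain ⟨c, rfl⟩ := Ideal.mem_span_singleton'.1 hv
  have hac : a - z * c ∈ K := by
    apply hx
    have : x * (a - z * c) = k + z * k' := by linear_combination -e - z * e'
    rw [this]
    exact add_mem hk (Ideal.mul_mem_left _ _ hk')
  have : a = (a - z * c) + c * z := by ring
  rw [this]
  exact add_mem (Ideal.mem_sup_left hac)
    (Ideal.mem_sup_right (Ideal.mem_span_singleton'.2 ⟨c, rfl⟩))

/-- Dividing by a nonzerodivisor modulo `K` lowers the Krull dimension. -/
theorem IsRegularMod.ringKrullDim_succ_le {K : Ideal R} {x : R} (hx : IsRegularMod K x) :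
    ringKrullDim (R ⧸ (K ⊔ Ideal.span {x})) + 1 ≤ ringKrullDim (R ⧸ K) := by
  have hr : Ideal.Quotient.mk K x ∈ nonZeroDivisors (R ⧸ K) := by
    rw [mem_nonZeroDivisors_iff_right]
    intro a ha
    obtain ⟨a, rfl⟩ := Ideal.Quotient.mk_surjective a
    rw [← map_mul, Ideal.Quotient.eq_zero_iff_mem] at ha
    exact Ideal.Quotient.eq_zero_iff_mem.2 (hx a (by rwa [mul_comm]))
  have h := ringKrullDim_quotient_succ_le_of_nonZeroDivisor hr
  have e := ringKrullDim_eq_of_ringEquiv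
    (DoubleQuot.quotQuotEquivQuotSup K (Ideal.span {x}))
  rw [Ideal.map_span, Set.image_singleton] at e
  rwa [e] at h

/-- Prime avoidance: if no nonzero element of `M` is killed by `I`, then some element of `I` is a
nonzerodivisor on `M`. -/
theorem exists_mem_forall_smul_eq_zero_imp [IsNoetherianRing R] {M : Type*} [AddCommGroup M]
    [Module R M] [Module.Finite R M] {I : Ideal R}
    (h : ∀ m : M, (∀ r ∈ I, r • m = 0) → m = 0) :
    ∃ z ∈ I, ∀ m : M, z • m = 0 → m = 0 := by
  by_contra! hcon
  have hsub : (I : Set R) ⊆ ⋃ p ∈ associatedPrimes R M, (p : Set R) := by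
    rw [biUnion_associatedPrimes_eq_zero_divisors]
    intro z hz
    obtain ⟨m, hm, hm0⟩ := hcon z hz
    exact ⟨m, hm0, hm⟩
  obtain ⟨P, hP, hIP⟩ := (I.subset_union_prime_finite (associatedPrimes.finite R M) (f := id)
    0 0 fun _ h _ _ ↦ h.1).1 hsub
  rw [AssociatedPrimes.mem_iff, isAssociatedPrime_iff] at hP
  obtain ⟨hprime, m, rfl⟩ := hP
  refine hprime.ne_top ?_
  have : m = 0 := h m fun r hr => by simpa using hIP hr
  simp [this]

end RegularModulo

/-! ### Depth and exchange of regular elements. -/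

section Depth

variable {R : Type*} [CommRing R] [IsLocalRing R]

/-- The maximal ideal of `R` contains a weakly `R / K`-regular sequence of length `n`. -/
def HasDepthMod : ℕ → Ideal R → Prop
  | 0, _ => True
  | n + 1, K => ∃ z ∈ maximalIdeal R, IsRegularMod K z ∧ HasDepthMod n (K ⊔ Ideal.span {z})

/-- The residue field of `R` does not embed into `R / K`. -/
def SocleFree (K : Ideal R) : Prop :=
  ∀ a, (∀ r ∈ maximalIdeal R, r * a ∈ K) → a ∈ K

theorem IsRegularMod.socleFree {K : Ideal R} {z : R} (hz : z ∈ maximalIdeal R)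
    (h : IsRegularMod K z) : SocleFree K :=
  fun a ha => h a (ha z hz)

/-- Prime avoidance on the product `R/K₁ × R/K₂` serves both quotients at once. -/
theorem exists_isRegularMod_of_socleFree [IsNoetherianRing R] {K₁ K₂ : Ideal R}
    (h₁ : SocleFree K₁) (h₂ : SocleFree K₂) :
    ∃ z ∈ maximalIdeal R, IsRegularMod K₁ z ∧ IsRegularMod K₂ z := by
  have key : ∀ {K : Ideal R} {r a : R}, r • Ideal.Quotient.mk K a = 0 ↔ r * a ∈ K := by
    intro K r a
    rw [← Ideal.Quotient.eq_zero_iff_mem, map_mul, Algebra.smul_def]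
    rfl
  obtain ⟨z, hz, h⟩ := exists_mem_forall_smul_eq_zero_imp
    (M := (R ⧸ K₁) × (R ⧸ K₂)) (I := maximalIdeal R) (by
      rintro ⟨a, b⟩ h
      obtain ⟨a, rfl⟩ := Ideal.Quotient.mk_surjective a
      obtain ⟨b, rfl⟩ := Ideal.Quotient.mk_surjective b
      simp only [Prod.smul_mk, Prod.mk_eq_zero, key] at h
      simp only [Prod.mk_eq_zero, Ideal.Quotient.eq_zero_iff_mem]
      exact ⟨h₁ a fun r hr => (h r hr).1, h₂ b fun r hr => (h r hr).2⟩)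
  refine ⟨z, hz, fun a ha => ?_, fun a ha => ?_⟩
  · have := h (Ideal.Quotient.mk K₁ a, 0) (by simpa [key] using ha)
    simpa [Ideal.Quotient.eq_zero_iff_mem] using this
  · have := h (0, Ideal.Quotient.mk K₂ a) (by simpa [key] using ha)
    simpa [Ideal.Quotient.eq_zero_iff_mem] using this

/-- The socles of `R / (K + (x))` and `R / (K + (y))` vanish simultaneously when `x` and `y` are
regular modulo `K`. -/
theorem SocleFree.exchange {K : Ideal R} {x y : R} (hxm : x ∈ maximalIdeal R)
    (hx : IsRegularMod K x) (hy : IsRegularMod K y)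
    (h : SocleFree (K ⊔ Ideal.span {x})) : SocleFree (K ⊔ Ideal.span {y}) := by
  intro b hb
  -- Both socles compute `Ext¹` of the residue field with values in `R/K`; explicitly, the relation
  -- `x b ≡ a y` modulo `K` matches `b` with `a`.
  obtain ⟨k, hk, w, hw, e⟩ := Submodule.mem_sup.1 (hb x hxm)
  obtain ⟨a, rfl⟩ := Ideal.mem_span_singleton'.1 hw
  have ha : a ∈ K ⊔ Ideal.span {x} := by
    apply h
    intro r hr
    obtain ⟨k', hk', w, hw, e'⟩ := Submodule.mem_sup.1 (hb r hr)
    obtain ⟨c, rfl⟩ := Ideal.mem_span_singleton'.1 hw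
    have : r * a - c * x ∈ K := by
      apply hy
      have : y * (r * a - c * x) = x * k' - r * k := by linear_combination r * e - x * e'
      rw [this]
      exact sub_mem (Ideal.mul_mem_left _ _ hk') (Ideal.mul_mem_left _ _ hk)
    rw [show r * a = (r * a - c * x) + c * x by ring]
    exact add_mem (Ideal.mem_sup_left this)
      (Ideal.mem_sup_right (Ideal.mem_span_singleton'.2 ⟨c, rfl⟩))
  obtain ⟨k', hk', w, hw, e'⟩ := Submodule.mem_sup.1 ha
  obtain ⟨c, rfl⟩ := Ideal.mem_span_singleton'.1 hw
  have : b - c * y ∈ K := by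
    apply hx
    have : x * (b - c * y) = k + y * k' := by linear_combination -e - y * e'
    rw [this]
    exact add_mem hk (Ideal.mul_mem_left _ _ hk')
  rw [show b = (b - c * y) + c * y by ring]
  exact add_mem (Ideal.mem_sup_left this)
    (Ideal.mem_sup_right (Ideal.mem_span_singleton'.2 ⟨c, rfl⟩))

/-- Depth drops by at most one modulo a nonzerodivisor. -/
theorem HasDepthMod.of_isRegularMod [IsNoetherianRing R] {n : ℕ} {K : Ideal R} {x : R}
    (h : HasDepthMod (n + 1) K) (hxm : x ∈ maximalIdeal R) (hx : IsRegularMod K x) :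
    HasDepthMod n (K ⊔ Ideal.span {x}) := by
  induction n generalizing K x with
  | zero => trivial
  | succ n ih =>
    obtain ⟨y, hym, hy, hKy⟩ := h
    have hsy : SocleFree (K ⊔ Ideal.span {y}) := by
      obtain ⟨w, hwm, hw, -⟩ := hKy
      exact hw.socleFree hwm
    -- `z` mediates between `y` and `x`: induction applies to `z` modulo `K + (y)`, then to `x`
    -- modulo `K + (z)`.
    obtain ⟨z, hzm, hzx, hzy⟩ :=
      exists_isRegularMod_of_socleFree (hsy.exchange hym hy hx) hsy
    have h1 := ih hKy hzm hzy
    rw [sup_right_comm] at h1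
    have h2 : HasDepthMod (n + 1) (K ⊔ Ideal.span {z}) := ⟨y, hym, hy.sup_span_swap hzy, h1⟩
    have h3 := ih h2 hxm (hx.sup_span_swap hzx)
    rw [sup_right_comm] at h3
    exact ⟨z, hzm, hzx, h3⟩

theorem hasDepthMod_of_forall_isRegularMod (rs : List R) (K : Ideal R)
    (hm : ∀ r ∈ rs, r ∈ maximalIdeal R)
    (h : ∀ (i : ℕ) (hi : i < rs.length), IsRegularMod (K ⊔ Ideal.ofList (rs.take i)) rs[i]) :
    HasDepthMod rs.length K := by
  induction rs generalizing K with
  | nil => trivial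
  | cons r rs ih =>
    refine ⟨r, hm r (by simp), ?_, ih _ (fun s hs => hm s (by simp [hs])) ?_⟩
    · have := h 0 (by simp)
      simp only [List.take_zero, Ideal.ofList_nil, sup_bot_eq] at this
      exact this
    intro i hi
    have := h (i + 1) (by simpa using hi)
    rwa [List.take_succ_cons, Ideal.ofList_cons, ← sup_assoc] at this

theorem IsCohenMacaulayLocal.hasDepthMod (hR : IsCohenMacaulayLocal R) {d : ℕ}
    (hdim : ringKrullDim R = d) : HasDepthMod d (⊥ : Ideal R) := by
  obtain ⟨-, rs, hm, hreg, hlen⟩ := hR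
  have : rs.length = d := by
    rw [hdim] at hlen
    exact_mod_cast hlen
  rw [← this]
  refine hasDepthMod_of_forall_isRegularMod rs ⊥ hm fun i hi a ha => ?_
  rw [bot_sup_eq] at ha ⊢
  have h := hreg.regular_mod_prev i hi
  rw [smul_eq_mul, Ideal.mul_top] at h
  have h0 := h.right_eq_zero_of_smul (x := Ideal.Quotient.mk _ a) (by
    rw [← Ideal.Quotient.mk_eq_mk, ← Submodule.Quotient.mk_smul, Submodule.Quotient.mk_eq_zero]
    exact ha)
  exact Ideal.Quotient.eq_zero_iff_mem.1 h0

/-- A ring of positive depth has a nonzerodivisor in each ideal primary to the maximal ideal. -/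
theorem HasDepthMod.exists_mem_isRegularMod {n : ℕ} {K I : Ideal R}
    (h : HasDepthMod (n + 1) K) (hI : I.radical = maximalIdeal R) :
    ∃ z ∈ I, IsRegularMod K z := by
  obtain ⟨z, hzm, hz, -⟩ := h
  rw [← hI] at hzm
  obtain ⟨k, hk⟩ := hzm
  exact ⟨z ^ k, hk, hz.pow k⟩

end Depth

/-! ### Generic elements over an infinite residue field. -/

section GenericElement

/-- A nonzero cyclic submodule surjects onto the residue field. -/
theorem infinite_of_nontrivial_of_infinite_residueField {R : Type*} [CommRing R] [IsLocalRing R]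
    [Infinite (ResidueField R)] (M : Type*) [AddCommGroup M] [Module R M] [Nontrivial M] :
    Infinite M := by
  obtain ⟨v, hv⟩ := exists_ne (0 : M)
  by_contra hfin
  rw [not_infinite_iff_finite] at hfin
  let f : R ⧸ LinearMap.ker (LinearMap.toSpanSingleton R M v) → M :=
    (LinearMap.ker (LinearMap.toSpanSingleton R M v)).liftQ _ le_rfl
  have hf : Function.Injective f := by
    rw [← LinearMap.ker_eq_bot]
    exact Submodule.ker_liftQ_eq_bot _ _ _ le_rfl
  have : Finite (R ⧸ LinearMap.ker (LinearMap.toSpanSingleton R M v)) := Finite.of_injective f hf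
  have hle : LinearMap.ker (LinearMap.toSpanSingleton R M v) ≤ maximalIdeal R := by
    refine le_maximalIdeal fun htop => hv ?_
    have : (1 : R) ∈ LinearMap.ker (LinearMap.toSpanSingleton R M v) := htop ▸ Submodule.mem_top
    simpa using this
  have : Finite (ResidueField R) :=
    Finite.of_surjective (β := R ⧸ maximalIdeal R) _ (Ideal.Quotient.factor_surjective hle)
  exact _root_.not_finite (ResidueField R)

/-- Over a local ring with infinite residue field, no module is a finite union of proper
submodules. -/
theorem exists_forall_notMem_of_infinite_residueField {R : Type*} [CommRing R] [IsLocalRing R]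
    [Infinite (ResidueField R)] {M : Type*} [AddCommGroup M] [Module R M] {ι : Type*}
    {s : Set ι} (hs : s.Finite) (p : ι → Submodule R M) (hp : ∀ i ∈ s, p i ≠ ⊤) :
    ∃ m : M, ∀ i ∈ s, m ∉ p i := by
  by_contra! hcon
  obtain ⟨t, rfl⟩ := hs.exists_finset_coe
  have hcov : ⋃ i ∈ t, (p i : Set M) = Set.univ := by
    refine Set.eq_univ_of_forall fun m => ?_
    obtain ⟨i, hi, hm⟩ := hcon m
    exact Set.mem_biUnion hi hm
  -- B. H. Neumann: in a finite cover by subgroups, one of them has finite index.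
  obtain ⟨k, hk, hfi⟩ := Submodule.exists_finiteIndex_of_cover hcov
  have : Finite (M ⧸ p k) := AddSubgroup.finite_quotient_of_finiteIndex
  have : Nontrivial (M ⧸ p k) := Submodule.Quotient.nontrivial_iff.mpr (hp k hk)
  have := infinite_of_nontrivial_of_infinite_residueField (R := R) (M ⧸ p k)
  exact _root_.not_finite (M ⧸ p k)

/-- If `ξ` avoids the associated primes of `S / 𝔞` that do not contain `T`, then `ξ` is a
nonzerodivisor on the part of `S / 𝔞` lying in a high power of `T`. -/
theorem exists_pow_forall_mul_mem_imp {S : Type*} [CommRing S] [IsNoetherianRing S]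
    (𝔞 T : Ideal S) (ξ : S) (hξ : ∀ P ∈ associatedPrimes S (S ⧸ 𝔞), ξ ∈ P → T ≤ P) :
    ∃ k : ℕ, ∀ f ∈ T ^ k, ξ * f ∈ 𝔞 → f ∈ 𝔞 := by
  let N : Submodule S (S ⧸ 𝔞) := LinearMap.ker (LinearMap.lsmul S (S ⧸ 𝔞) ξ)
  -- A minimal prime of the annihilator of `N` is associated to `N`, hence to `S/𝔞`, and contains
  -- `ξ` since `ξN = 0`.
  have hT : T ≤ (Module.annihilator S N).radical := by
    rw [← Ideal.sInf_minimalPrimes]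
    refine le_sInf fun P hP => ?_
    have hP' := Module.associatedPrimes.minimalPrimes_annihilator_subset_associatedPrimes S N hP
    refine hξ P (associatedPrimes.subset_of_injective N.injective_subtype hP') ?_
    refine hP.1.2 (Module.mem_annihilator.2 fun n => Subtype.ext ?_)
    exact n.2
  obtain ⟨n, hn⟩ := Ideal.exists_pow_le_of_le_radical_of_fg hT (IsNoetherian.noetherian T)
  -- By Artin–Rees, `T^(m+n)(S/𝔞) ∩ N ⊆ Tⁿ N = 0`.
  obtain ⟨m, hm⟩ := Ideal.exists_pow_inf_eq_pow_smul T N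
  refine ⟨m + n, fun f hf hξf => ?_⟩
  have hmem : (Ideal.Quotient.mk 𝔞 f : S ⧸ 𝔞) ∈ (T ^ (m + n) • ⊤ ⊓ N : Submodule S (S ⧸ 𝔞)) := by
    refine ⟨?_, ?_⟩
    · have : f • (1 : S ⧸ 𝔞) ∈ (T ^ (m + n) • ⊤ : Submodule S (S ⧸ 𝔞)) :=
        Submodule.smul_mem_smul hf Submodule.mem_top
      rwa [Algebra.smul_def, mul_one] at this
    · change ξ • (Ideal.Quotient.mk 𝔞 f : S ⧸ 𝔞) = 0
      rw [Algebra.smul_def]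
      exact (map_mul (Ideal.Quotient.mk 𝔞) ξ f).symm.trans
        (Ideal.Quotient.eq_zero_iff_mem.2 hξf)
  rw [hm _ (Nat.le_add_right m n), Nat.add_sub_cancel_left] at hmem
  have hle : (T ^ n • (T ^ m • ⊤ ⊓ N) : Submodule S (S ⧸ 𝔞)) ≤ ⊥ := by
    refine Submodule.smul_le.2 fun r hr v hv => ?_
    have := Module.mem_annihilator.1 (hn hr) ⟨v, hv.2⟩
    simpa using congrArg Subtype.val this
  exact Ideal.Quotient.eq_zero_iff_mem.1 (by simpa using hle hmem)

end GenericElement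

/-! ### Superficial elements from the Rees algebra. -/

section Rees

variable {A : Type*} [CommRing A] (I : Ideal A)

/-- The element `a tⁿ` of the Rees algebra. -/
noncomputable def reesMonomial (n : ℕ) (a : A) (ha : a ∈ I ^ n) : reesAlgebra I :=
  ⟨monomial n a, reesAlgebra.monomial_mem.2 ha⟩

/-- The kernel `⨁ Iⁿ⁺¹ tⁿ` of the projection from the Rees algebra to the associated graded
ring. -/
noncomputable def reesGradedKernel : Ideal (reesAlgebra I) where
  carrier := {f | ∀ i, (f : A[X]).coeff i ∈ I ^ (i + 1)}
  zero_mem' := fun i => by simp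
  add_mem' := fun hf hg i => by
    rw [Subalgebra.coe_add, coeff_add]
    exact add_mem (hf i) (hg i)
  smul_mem' := fun f g hg i => by
    rw [smul_eq_mul, Subalgebra.coe_mul, coeff_mul]
    refine sum_mem fun p hp => ?_
    rw [← Finset.HasAntidiagonal.mem_antidiagonal.1 hp, add_assoc, pow_add]
    exact Ideal.mul_mem_mul ((mem_reesAlgebra_iff I _).1 f.2 _) (hg _)

/-- The ideal of the Rees algebra generated by its elements of degree one. -/
noncomputable def reesIrrelevant : Ideal (reesAlgebra I) :=
  Ideal.span {f | ∃ (a : A) (ha : a ∈ I ^ 1), f = reesMonomial I 1 a ha}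

theorem reesMonomial_mem_pow (n : ℕ) (a : A) (ha : a ∈ I ^ n) :
    reesMonomial I n a ha ∈ reesIrrelevant I ^ n := by
  suffices h : ∀ a ∈ I ^ n, ∃ ha : a ∈ I ^ n, reesMonomial I n a ha ∈ reesIrrelevant I ^ n from
    (h a ha).2
  clear ha a
  induction n with
  | zero => simp
  | succ n ih =>
    intro a ha
    rw [pow_succ'] at ha
    refine Submodule.mul_induction_on ha (fun u hu v hv => ?_) ?_
    · obtain ⟨_, hv'⟩ := ih v hv
      have huv : u * v ∈ I ^ (n + 1) := pow_succ' I n ▸ Ideal.mul_mem_mul hu hv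
      have e : reesMonomial I (n + 1) (u * v) huv =
          reesMonomial I 1 u (by simpa using hu) * reesMonomial I n v hv :=
        Subtype.ext (by simp [reesMonomial, monomial_mul_monomial, add_comm])
      refine ⟨huv, ?_⟩
      rw [e, pow_succ']
      exact Ideal.mul_mem_mul (Ideal.subset_span ⟨u, _, rfl⟩) hv'
    · rintro u v ⟨hu, hu'⟩ ⟨hv, hv'⟩
      have e : reesMonomial I (n + 1) (u + v) (add_mem hu hv) =
          reesMonomial I (n + 1) u hu + reesMonomial I (n + 1) v hv :=
        Subtype.ext (by simp [reesMonomial])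
      exact ⟨add_mem hu hv, e ▸ add_mem hu' hv'⟩

theorem reesMonomial_mem_gradedKernel_iff (n : ℕ) (a : A) (ha : a ∈ I ^ n) :
    reesMonomial I n a ha ∈ reesGradedKernel I ↔ a ∈ I ^ (n + 1) := by
  refine ⟨fun h => by simpa [reesMonomial] using h n, fun h i => ?_⟩
  rcases eq_or_ne n i with rfl | hi
  · simpa [reesMonomial] using h
  · simp [reesMonomial, coeff_monomial, hi]

/-- The elements of `I` whose initial form of degree one lies in the ideal `P` of the Rees
algebra. -/
noncomputable def reesDegreeOne (P : Ideal (reesAlgebra I)) : Submodule A I where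
  carrier := {a | reesMonomial I 1 a (by simp) ∈ P}
  zero_mem' := by
    have : reesMonomial I 1 0 (zero_mem _) = 0 := Subtype.ext (by simp [reesMonomial])
    change reesMonomial I 1 0 _ ∈ P
    rw [this]
    exact zero_mem _
  add_mem' := fun {a b} ha hb => by
    have : reesMonomial I 1 (a + b : A) (by simp [add_mem]) =
        reesMonomial I 1 a (by simp) + reesMonomial I 1 b (by simp) :=
      Subtype.ext (by simp [reesMonomial])
    change reesMonomial I 1 (a + b : A) _ ∈ P
    rw [this]
    exact add_mem ha hb
  smul_mem' := fun r {a} ha => by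
    have : reesMonomial I 1 (r * a : A) (by simp [Ideal.mul_mem_left]) =
        algebraMap A (reesAlgebra I) r * reesMonomial I 1 a (by simp) :=
      Subtype.ext (by simp [reesMonomial, Algebra.algebraMap_eq_smul_one, smul_monomial])
    change reesMonomial I 1 (r * a : A) _ ∈ P
    rw [this]
    exact Ideal.mul_mem_left _ _ ha

/-- Existence of superficial elements. -/
theorem exists_superficial [IsNoetherianRing A] [IsLocalRing A] [Infinite (ResidueField A)] :
    ∃ x ∈ I, ∃ c : ℕ, ∀ n ≥ c, ∀ a ∈ I ^ c, x * a ∈ I ^ (n + 1) → a ∈ I ^ n := by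
  obtain ⟨x, hx⟩ := exists_forall_notMem_of_infinite_residueField
    (s := associatedPrimes (reesAlgebra I) (reesAlgebra I ⧸ reesGradedKernel I) ∩
      {P | ¬ reesIrrelevant I ≤ P})
    ((associatedPrimes.finite _ _).inter_of_left _) (reesDegreeOne I) (by
      rintro P ⟨-, hP⟩ htop
      refine hP (Ideal.span_le.2 ?_)
      rintro _ ⟨a, ha, rfl⟩
      have : (⟨a, by simpa using ha⟩ : I) ∈ reesDegreeOne I P := htop ▸ Submodule.mem_top
      exact this)
  obtain ⟨k, hk⟩ := exists_pow_forall_mul_mem_imp (reesGradedKernel I) (reesIrrelevant I)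
    (reesMonomial I 1 x (by simp)) (fun P hP hxP => by
      by_contra hcon
      exact hx P ⟨hP, hcon⟩ hxP)
  refine ⟨x, x.2, k, fun n hn a ha hxa => ?_⟩
  -- Regularity of the initial form of `x` in high degree raises the order of `a` one step at a
  -- time.
  induction n, hn using Nat.le_induction with
  | base => exact ha
  | succ n hn ih =>
    have han : a ∈ I ^ n := ih (Ideal.pow_le_pow_right (Nat.le_succ _) hxa)
    rw [← reesMonomial_mem_gradedKernel_iff I n a han]
    refine hk _ (Ideal.pow_le_pow_right hn (reesMonomial_mem_pow I n a han)) ?_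
    have e : reesMonomial I 1 x (by simp) * reesMonomial I n a han =
        reesMonomial I (n + 1) (x * a) (Ideal.pow_le_pow_right (Nat.le_succ _) hxa) :=
      Subtype.ext (by simp [reesMonomial, monomial_mul_monomial, add_comm])
    rw [e, reesMonomial_mem_gradedKernel_iff]
    exact hxa

end Rees

/-! ### Superficial elements in quotient rings. -/

section SuperficialModulo

variable {R : Type*} [CommRing R]

theorem mk_mem_map_pow_iff {I K : Ideal R} {n : ℕ} {a : R} :
    Ideal.Quotient.mk K a ∈ I.map (Ideal.Quotient.mk K) ^ n ↔ a ∈ I ^ n ⊔ K := by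
  rw [← Ideal.map_pow, ← Ideal.mem_comap,
    Ideal.comap_map_of_surjective' _ Ideal.Quotient.mk_surjective, Ideal.mk_ker]

/-- The image of `x` in `R / K` satisfies the colon condition of a superficial element for the
image of `I`. -/
def IsSuperficialMod (I K : Ideal R) (x : R) : Prop :=
  ∃ c : ℕ, ∀ n ≥ c, ∀ a ∈ I ^ c ⊔ K, x * a ∈ I ^ (n + 1) ⊔ K → a ∈ I ^ n ⊔ K

theorem IsSuperficial.isSuperficialMod {I K : Ideal R} {x : R}
    (h : IsSuperficial (I.map (Ideal.Quotient.mk K)) (Ideal.Quotient.mk K x)) :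
    IsSuperficialMod I K x := by
  obtain ⟨-, c, -, hc⟩ := h
  refine ⟨c, fun n hn a ha hxa => ?_⟩
  rw [← mk_mem_map_pow_iff, ← hc n hn]
  refine ⟨?_, mk_mem_map_pow_iff.2 ha⟩
  rw [SetLike.mem_coe, Submodule.mem_colon_singleton, smul_eq_mul, ← map_mul, mul_comm]
  exact mk_mem_map_pow_iff.2 hxa

theorem exists_isSuperficialMod [IsNoetherianRing R] [IsLocalRing R] [Infinite (ResidueField R)]
    (I : Ideal R) {K : Ideal R} (hK : K ≠ ⊤) : ∃ x ∈ I, IsSuperficialMod I K x := by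
  have : Nontrivial (R ⧸ K) := Ideal.Quotient.nontrivial_iff.2 hK
  have : IsLocalRing (R ⧸ K) :=
    IsLocalRing.of_surjective' (Ideal.Quotient.mk K) Ideal.Quotient.mk_surjective
  have : IsLocalHom (Ideal.Quotient.mk K) :=
    IsLocalHom.of_surjective _ Ideal.Quotient.mk_surjective
  have : Infinite (ResidueField (R ⧸ K)) :=
    Infinite.of_injective _ (ResidueField.map (Ideal.Quotient.mk K)).injective
  obtain ⟨y, hy, c, hc⟩ := exists_superficial (I.map (Ideal.Quotient.mk K))
  obtain ⟨x, hx, rfl⟩ :=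
    (Ideal.mem_map_iff_of_surjective _ Ideal.Quotient.mk_surjective).1 hy
  refine ⟨x, hx, c, fun n hn a ha hxa => ?_⟩
  exact mk_mem_map_pow_iff.1 (hc n hn _ (mk_mem_map_pow_iff.2 ha)
    (by rw [← map_mul]; exact mk_mem_map_pow_iff.2 hxa))

theorem mk_mem_pow_smul_top_iff {I K : Ideal R} {n : ℕ} {a : R} :
    Ideal.Quotient.mk K a ∈ (I ^ n • ⊤ : Submodule R (R ⧸ K)) ↔ a ∈ I ^ n ⊔ K := by
  rw [Ideal.smul_top_eq_map, Submodule.restrictScalars_mem, Ideal.map_pow]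
  exact mk_mem_map_pow_iff

/-- Krull's intersection theorem in `R / K`. -/
theorem mem_of_forall_mem_pow_sup [IsNoetherianRing R] [IsLocalRing R] {I K : Ideal R}
    (hI : I ≠ ⊤) {a : R} (h : ∀ n, a ∈ I ^ n ⊔ K) : a ∈ K := by
  rw [← Ideal.Quotient.eq_zero_iff_mem, ← Submodule.mem_bot R,
    ← Ideal.iInf_pow_smul_eq_bot_of_isLocalRing I hI, Submodule.mem_iInf]
  exact fun n => mk_mem_pow_smul_top_iff.2 (h n)

/-- If `x a ∈ K`, then `y^c a` satisfies the colon condition in every degree, so it lies in `K` by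
Krull intersection, and `y^c` cancels. -/
theorem IsSuperficialMod.isRegularMod [IsNoetherianRing R] [IsLocalRing R] {I K : Ideal R}
    {x y : R} (h : IsSuperficialMod I K x) (hI : I ≠ ⊤) (hy : y ∈ I) (hyK : IsRegularMod K y) :
    IsRegularMod K x := by
  obtain ⟨c, hc⟩ := h
  intro a ha
  refine hyK.pow c a (mem_of_forall_mem_pow_sup hI fun n => ?_)
  have : y ^ c * a ∈ I ^ (n + c) ⊔ K :=
    hc (n + c) (Nat.le_add_left _ _) _
      (Ideal.mem_sup_left (Ideal.mul_mem_right _ _ (Ideal.pow_mem_pow hy c)))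
      (Ideal.mem_sup_right (by
        rw [mul_left_comm]
        exact Ideal.mul_mem_left _ _ ha))
  exact sup_le_sup_right (Ideal.pow_le_pow_right (Nat.le_add_right _ _)) K this

/-- The Artin–Rees lemma for a nonzerodivisor modulo `K`. -/
theorem IsRegularMod.exists_forall_mem_pow_sup [IsNoetherianRing R] {K : Ideal R} {x : R}
    (hx : IsRegularMod K x) (I : Ideal R) :
    ∃ k : ℕ, ∀ n a, x * a ∈ I ^ (n + k) ⊔ K → a ∈ I ^ n ⊔ K := by
  let f : R ⧸ K →ₗ[R] R ⧸ K := LinearMap.lsmul R (R ⧸ K) x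
  have hf : ∀ a, f (Ideal.Quotient.mk K a) = Ideal.Quotient.mk K (x * a) := fun a => by
    rw [map_mul]
    exact Algebra.smul_def _ _
  obtain ⟨k, hk⟩ := Ideal.exists_pow_inf_eq_pow_smul I (LinearMap.range f)
  refine ⟨k, fun n a ha => ?_⟩
  have hmem : Ideal.Quotient.mk K (x * a) ∈
      (I ^ (n + k) • ⊤ ⊓ LinearMap.range f : Submodule R (R ⧸ K)) :=
    ⟨mk_mem_pow_smul_top_iff.2 ha, ⟨_, hf a⟩⟩
  rw [hk _ (Nat.le_add_left k n), Nat.add_sub_cancel] at hmem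
  have hle : (I ^ n • (I ^ k • ⊤ ⊓ LinearMap.range f) : Submodule R (R ⧸ K)) ≤
      (I ^ n • ⊤ : Submodule R (R ⧸ K)).map f := by
    rw [Submodule.map_smul'', Submodule.map_top]
    exact smul_mono_right _ inf_le_right
  obtain ⟨b, hb, hb'⟩ := hle hmem
  obtain ⟨b, rfl⟩ := Ideal.Quotient.mk_surjective b
  rw [hf, Ideal.Quotient.mk_eq_mk_iff_sub_mem, ← mul_sub] at hb'
  have := hx _ hb'
  rw [show a = b - (b - a) by ring]
  exact sub_mem (mk_mem_pow_smul_top_iff.1 hb) (Ideal.mem_sup_right this)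

/-- For a nonzerodivisor, Artin–Rees makes the restriction to `I^c` automatic in large degree. -/
theorem IsSuperficialMod.exists_forall_mem_pow_sup [IsNoetherianRing R] {I K : Ideal R} {x : R}
    (h : IsSuperficialMod I K x) (hx : IsRegularMod K x) :
    ∃ N : ℕ, ∀ n ≥ N, ∀ a, x * a ∈ I ^ (n + 1) ⊔ K → a ∈ I ^ n ⊔ K := by
  obtain ⟨c, hc⟩ := h
  obtain ⟨k, hk⟩ := hx.exists_forall_mem_pow_sup I
  refine ⟨c + k, fun n hn a ha => hc n (by omega) a (hk c a ?_) ha⟩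
  exact sup_le_sup_right (Ideal.pow_le_pow_right (by omega)) K ha

/-- If a power of `I` lies in `K + (x)`, then a superficial nonzerodivisor `x` modulo `K`
generates a reduction of the image of `I`. -/
theorem exists_forall_pow_succ_le {I K : Ideal R} {x : R}
    (h : ∃ N : ℕ, ∀ n ≥ N, ∀ a, x * a ∈ I ^ (n + 1) ⊔ K → a ∈ I ^ n ⊔ K)
    {M : ℕ} (hM : I ^ M ≤ K ⊔ Ideal.span {x}) :
    ∃ N : ℕ, ∀ n ≥ N, I ^ (n + 1) ≤ Ideal.span {x} * (I ^ n ⊔ K) ⊔ K := by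
  obtain ⟨N, hN⟩ := h
  refine ⟨max N M, fun n hn a ha => ?_⟩
  obtain ⟨k, hk, w, hw, e⟩ := Submodule.mem_sup.1
    (hM (Ideal.pow_le_pow_right (by omega) ha))
  obtain ⟨b, rfl⟩ := Ideal.mem_span_singleton'.1 hw
  have hb : b ∈ I ^ n ⊔ K := hN n (by omega) b (by
    rw [show x * b = a - k by linear_combination e]
    exact sub_mem (Ideal.mem_sup_left ha) (Ideal.mem_sup_right hk))
  rw [← e, mul_comm b x]
  exact add_mem (Ideal.mem_sup_right hk)
    (Ideal.mem_sup_left (Ideal.mul_mem_mul (Ideal.mem_span_singleton_self x) hb))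

end SuperficialModulo

/-! ### The Ratliff–Rush filtration and its images. -/

section RatliffRushFiltration

variable {R : Type*} [CommRing R]

/-- The definition only tests exponents that are multiples of `n`, but a valid `k` may be enlarged
freely. Removing this dependence on `n` makes the closures of different powers comparable. -/
theorem mem_ratliffRush_pow_iff (I : Ideal R) (n : ℕ) (a : R) :
    a ∈ ratliffRush (I ^ n) ↔ ∃ k, ∀ b ∈ I ^ k, a * b ∈ I ^ (n + k) := by
  rw [mem_ratliffRush]
  simp only [← pow_mul]
  constructor
  · rintro ⟨k, -, h⟩
    refine ⟨n * k, fun b hb => ?_⟩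
    have := h b hb
    rwa [mul_add, mul_one, add_comm] at this
  · rintro ⟨k, h⟩
    rcases Nat.eq_zero_or_pos n with rfl | hn
    · exact ⟨1, le_rfl, fun b _ => by simp⟩
    · refine ⟨k + 1, by omega, fun b hb => ?_⟩
      have hk : n * (k + 1) = (n * (k + 1) - k) + k := by
        have : k + 1 ≤ n * (k + 1) := Nat.le_mul_of_pos_left _ hn
        omega
      have e : n * (k + 1 + 1) = (n * (k + 1) - k) + (n + k) := by
        rw [mul_add n (k + 1) 1]
        omega
      rw [hk, pow_add] at hb
      rw [e, pow_add]
      generalize n * (k + 1) - k = l at hb ⊢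
      refine Submodule.mul_induction_on hb (fun u hu v hv => ?_) (fun u v hu hv => ?_)
      · rw [mul_left_comm]
        exact Ideal.mul_mem_mul hu (h v hv)
      · rw [mul_add]
        exact add_mem hu hv

theorem ratliffRush_pow_zero (I : Ideal R) : ratliffRush (I ^ 0) = ⊤ := by
  refine (Ideal.eq_top_iff_one _).2 ((mem_ratliffRush_pow_iff I 0 1).2 ⟨0, by simp⟩)

theorem pow_le_ratliffRush (I : Ideal R) (n : ℕ) : I ^ n ≤ ratliffRush (I ^ n) :=
  fun a ha => (mem_ratliffRush_pow_iff I n a).2 ⟨0, fun _ _ => Ideal.mul_mem_right _ _ ha⟩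

theorem mul_mem_ratliffRush_pow_succ {I : Ideal R} {n : ℕ} {x a : R} (hx : x ∈ I)
    (ha : a ∈ ratliffRush (I ^ n)) : x * a ∈ ratliffRush (I ^ (n + 1)) := by
  obtain ⟨k, hk⟩ := (mem_ratliffRush_pow_iff I n a).1 ha
  refine (mem_ratliffRush_pow_iff I _ _).2 ⟨k, fun b hb => ?_⟩
  rw [mul_assoc, show n + 1 + k = (n + k) + 1 by omega, pow_succ']
  exact Ideal.mul_mem_mul hx (hk b hb)

/-- An element `a` of the closure has `x^k a ∈ I^(n+k)`, and the factors `x` cancel one by one. -/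
theorem ratliffRush_pow_eq_of_isSuperficial {I : Ideal R} {x : R} {N : ℕ} (hx : x ∈ I)
    (h : ∀ n ≥ N, ∀ a, x * a ∈ I ^ (n + 1) → a ∈ I ^ n) {n : ℕ} (hn : N ≤ n) :
    ratliffRush (I ^ n) = I ^ n := by
  refine le_antisymm (fun a ha => ?_) (pow_le_ratliffRush I n)
  obtain ⟨k, hk⟩ := (mem_ratliffRush_pow_iff I n a).1 ha
  have hak : x ^ k * a ∈ I ^ (n + k) := by
    rw [mul_comm]
    exact hk _ (Ideal.pow_mem_pow hx k)
  clear hk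
  induction k with
  | zero => simpa using hak
  | succ k ih =>
    refine ih (h (n + k) (by omega) _ ?_)
    rw [← mul_assoc, ← pow_succ']
    exact hak

/-- Membership in the Ratliff–Rush closure of the image of `I ^ n` in `R / K`. -/
theorem mk_mem_ratliffRush_map_pow_iff {I K : Ideal R} {n : ℕ} {a : R} :
    Ideal.Quotient.mk K a ∈ ratliffRush ((I ^ n).map (Ideal.Quotient.mk K)) ↔
      ∃ k, ∀ b ∈ I ^ k, a * b ∈ I ^ (n + k) ⊔ K := by
  rw [Ideal.map_pow, mem_ratliffRush_pow_iff]
  refine exists_congr fun k => ⟨fun h b hb => ?_, fun h b hb => ?_⟩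
  · rw [← mk_mem_map_pow_iff, map_mul]
    exact h _ (mk_mem_map_pow_iff.2 (Ideal.mem_sup_left hb))
  · rw [← Ideal.map_pow] at hb
    obtain ⟨b, hbI, rfl⟩ := (Ideal.mem_map_iff_of_surjective _ Ideal.Quotient.mk_surjective).1 hb
    rw [← map_mul]
    exact mk_mem_map_pow_iff.2 (h b hbI)

/-- If the Ratliff–Rush filtration behaves well modulo `K`, then a superficial nonzerodivisor
modulo `K` is regular on the associated graded ring of its image in `R / K`. -/
theorem mem_ratliffRush_sup_of_mul_mem {I K : Ideal R} {y : R}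
    (hwell : ∀ n, 1 ≤ n → (ratliffRush (I ^ n)).map (Ideal.Quotient.mk K) =
      ratliffRush ((I ^ n).map (Ideal.Quotient.mk K)))
    (hy : ∃ N : ℕ, ∀ n ≥ N, ∀ a, y * a ∈ I ^ (n + 1) ⊔ K → a ∈ I ^ n ⊔ K)
    {n : ℕ} {a : R} (ha : y * a ∈ ratliffRush (I ^ (n + 1)) ⊔ K) :
    a ∈ ratliffRush (I ^ n) ⊔ K := by
  have key : ∀ {n}, 1 ≤ n → ∀ {a : R}, a ∈ ratliffRush (I ^ n) ⊔ K ↔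
      ∃ k, ∀ b ∈ I ^ k, a * b ∈ I ^ (n + k) ⊔ K := by
    intro n hn a
    rw [← mk_mem_ratliffRush_map_pow_iff, ← hwell n hn, ← Ideal.mem_comap,
      Ideal.comap_map_of_surjective' _ Ideal.Quotient.mk_surjective, Ideal.mk_ker]
  rcases Nat.eq_zero_or_pos n with rfl | hn
  · rw [ratliffRush_pow_zero, top_sup_eq]
    trivial
  obtain ⟨k, hk⟩ := (key (by omega)).1 ha
  obtain ⟨N, hN⟩ := hy
  -- The extra `N` factors from `I` push the degree past the threshold beyond which `y` cancels.
  refine (key hn).2 ⟨k + N, fun b hb => hN _ (by omega) _ ?_⟩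
  rw [pow_add] at hb
  rw [← mul_assoc]
  refine Submodule.mul_induction_on hb (fun u hu v hv => ?_) (fun u v hu hv => ?_)
  · rw [← mul_assoc, show n + (k + N) + 1 = (n + 1 + k) + N by omega]
    have := Ideal.mul_mem_mul (hk u hu) hv
    rw [Ideal.sup_mul, ← pow_add] at this
    exact sup_le_sup_left Ideal.mul_le_left (I ^ (n + 1 + k + N)) this
  · rw [mul_add]
    exact add_mem hu hv

end RatliffRushFiltration

/-! ### Sally descent. -/

section SallyMachine

variable {R : Type*} [CommRing R]

/-- Descent of positive depth of the associated graded ring of a filtration `G`: if `y` is regular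
on the graded ring of the image of `G` modulo `x` and `x` is superficial for `G`, then `x` is
regular on the graded ring of `G`. -/
theorem mem_of_mul_mem_of_sup_span {G : ℕ → Ideal R} {x y : R} (h0 : G 0 = ⊤)
    (hxG : ∀ n, ∀ a ∈ G n, x * a ∈ G (n + 1)) (hyG : ∀ n, ∀ a ∈ G n, y * a ∈ G (n + 1))
    (hx : ∃ N : ℕ, ∀ n ≥ N, ∀ a, x * a ∈ G (n + 1) → a ∈ G n)
    (hy : ∀ n a, y * a ∈ G (n + 1) ⊔ Ideal.span {x} → a ∈ G n ⊔ Ideal.span {x}) :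
    ∀ n a, x * a ∈ G (n + 1) → a ∈ G n := by
  obtain ⟨N, hN⟩ := hx
  have hxj : ∀ j n, N ≤ n → ∀ a, x ^ j * a ∈ G (n + j) → a ∈ G n := by
    intro j
    induction j with
    | zero => intro n _ a ha; simpa using ha
    | succ j ih =>
      intro n hn a ha
      refine ih n hn a (hN _ (by omega) _ ?_)
      rw [← mul_assoc, ← pow_succ']
      exact ha
  have hxG' : ∀ j n, ∀ a ∈ G n, x ^ j * a ∈ G (n + j) := by
    intro j
    induction j with
    | zero => intro n a ha; simpa using ha
    | succ j ih =>
      intro n a ha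
      rw [pow_succ', mul_assoc]
      exact hxG _ _ (ih n a ha)
  have hyG' : ∀ j n, ∀ a ∈ G n, y ^ j * a ∈ G (n + j) := by
    intro j
    induction j with
    | zero => intro n a ha; simpa using ha
    | succ j ih =>
      intro n a ha
      rw [pow_succ', mul_assoc]
      exact hyG _ _ (ih n a ha)
  have hyj : ∀ j n a, y ^ j * a ∈ G (n + j) ⊔ Ideal.span {x} → a ∈ G n ⊔ Ideal.span {x} := by
    intro j
    induction j with
    | zero => intro n a ha; simpa using ha
    | succ j ih =>
      intro n a ha
      refine ih n a (hy _ _ ?_)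
      rw [← mul_assoc, ← pow_succ']
      exact ha
  -- All `j` are treated together: multiplying by `y^N` reaches degrees where `x` cancels, so `a = f
  -- + b x` with `f ∈ G (n + 1)`, and `b` satisfies the hypothesis for `n` with `j + 1`.
  have main : ∀ n j a, x ^ j * a ∈ G (n + j) → a ∈ G n := by
    intro n
    induction n with
    | zero => intro j a _; simp [h0]
    | succ n ih =>
      intro j a ha
      have h1 : y ^ N * a ∈ G (n + 1 + N) := by
        refine hxj j _ (by omega) _ ?_
        rw [mul_left_comm, add_right_comm]
        exact hyG' N _ _ ha
      obtain ⟨f, hf, w, hw, rfl⟩ := Submodule.mem_sup.1 (hyj N (n + 1) a (Ideal.mem_sup_left h1))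
      obtain ⟨b, rfl⟩ := Ideal.mem_span_singleton'.1 hw
      have hb : b ∈ G n := by
        refine ih (j + 1) b ?_
        have e : x ^ (j + 1) * b = x ^ j * (f + b * x) - x ^ j * f := by ring
        rw [e, show n + (j + 1) = n + 1 + j by omega]
        exact sub_mem ha (hxG' j _ f hf)
      refine add_mem hf ?_
      rw [mul_comm]
      exact hxG n b hb
  exact fun n a ha => main n 1 a (by simpa using ha)

end SallyMachine

/-! ### Finite differences and alternating signs. -/

section ForwardDifference

theorem fwdDiff_iter_congr_of_ge {f g : ℕ → ℚ} {N : ℕ} (h : ∀ n ≥ N, f n = g n) (i : ℕ) :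
    ∀ n ≥ N, (fwdDiff 1)^[i] f n = (fwdDiff 1)^[i] g n := by
  induction i with
  | zero => exact h
  | succ i ih =>
    intro n hn
    rw [Function.iterate_succ_apply', Function.iterate_succ_apply', fwdDiff, fwdDiff, ih n hn,
      ih (n + 1) (by omega)]

theorem fwdDiff_iter_sub_apply (f g : ℕ → ℚ) (i n : ℕ) :
    (fwdDiff 1)^[i] (fun k => f k - g k) n = (fwdDiff 1)^[i] f n - (fwdDiff 1)^[i] g n := by
  induction i generalizing n with
  | zero => rfl
  | succ i ih =>
    simp only [Function.iterate_succ_apply', fwdDiff, ih]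
    ring

theorem exists_polynomial_fwdDiff_iter_eval (P : ℚ[X]) (i : ℕ) :
    ∃ Q : ℚ[X], ∀ n : ℕ, (fwdDiff 1)^[i] (fun k : ℕ => P.eval (k : ℚ)) n = Q.eval (n : ℚ) := by
  induction i with
  | zero => exact ⟨P, fun _ => rfl⟩
  | succ i ih =>
    obtain ⟨Q, hQ⟩ := ih
    refine ⟨Q.comp (X + 1) - Q, fun n => ?_⟩
    rw [Function.iterate_succ_apply', fwdDiff, hQ, hQ]
    simp

theorem eval_eq_of_eventually_eq {Q : ℚ[X]} {e : ℚ} {N : ℕ}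
    (h : ∀ n ≥ N, Q.eval (n : ℚ) = e) (n : ℕ) : Q.eval (n : ℚ) = e := by
  have : Q = C e := by
    refine Polynomial.eq_of_infinite_eval_eq _ _
      (((Set.Ici_infinite N).image (Nat.cast_injective (R := ℚ)).injOn).mono ?_)
    rintro _ ⟨n, hn, rfl⟩
    simpa using h n hn
  simp [this]

/-- A function with eventually constant iterated difference is eventually a polynomial. -/
theorem exists_polynomial_of_fwdDiff_iter_eq {f : ℕ → ℚ} {d N : ℕ} {e : ℚ}
    (h : ∀ n ≥ N, (fwdDiff 1)^[d] f n = e) : ∃ P : ℚ[X], ∀ n ≥ N, P.eval (n : ℚ) = f n := by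
  have hzero : ∀ k > d, ∀ n ≥ N, (fwdDiff 1)^[k] f n = 0 := by
    intro k hk
    induction k, hk using Nat.le_induction with
    | base =>
      intro n hn
      rw [Nat.succ_eq_add_one, Function.iterate_succ_apply', fwdDiff, h n hn,
        h (n + 1) (by omega), sub_self]
    | succ k hk ih =>
      intro n hn
      rw [Function.iterate_succ_apply', fwdDiff, ih n hn, ih (n + 1) (by omega), sub_self]
  -- Newton interpolation at `N`: the sum of `Δᵏf(N)` times the binomial polynomial of `X - N` over
  -- `k`.
  refine ⟨∑ k ∈ Finset.range (d + 1),
    C ((fwdDiff 1)^[k] f N / k.factorial) * (descPochhammer ℚ k).comp (X - C (N : ℚ)),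
    fun n hn => ?_⟩
  obtain ⟨m, rfl⟩ := Nat.exists_eq_add_of_le hn
  have hnewton := shift_eq_sum_fwdDiff_iter 1 f m N
  rw [smul_eq_mul, mul_one] at hnewton
  rw [hnewton, eval_finsetSum]
  -- Both sums extend to a common range: binomials vanish for `k > m`, differences for `k > d`.
  have h1 : ∑ k ∈ Finset.range (m + 1), m.choose k • (fwdDiff 1)^[k] f N =
      ∑ k ∈ Finset.range (m + d + 1), m.choose k • (fwdDiff 1)^[k] f N := by
    refine Finset.sum_subset (Finset.range_mono (by omega)) fun k _ hk => ?_
    rw [Finset.mem_range, not_lt] at hk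
    rw [Nat.choose_eq_zero_of_lt (by omega), zero_smul]
  have h2 : ∑ k ∈ Finset.range (d + 1), m.choose k • (fwdDiff 1)^[k] f N =
      ∑ k ∈ Finset.range (m + d + 1), m.choose k • (fwdDiff 1)^[k] f N := by
    refine Finset.sum_subset (Finset.range_mono (by omega)) fun k _ hk => ?_
    rw [Finset.mem_range, not_lt] at hk
    rw [hzero k (by omega) N le_rfl, smul_zero]
  rw [h1, ← h2]
  refine Finset.sum_congr rfl fun k _ => ?_
  have hk : (k.factorial : ℚ) ≠ 0 := by exact_mod_cast k.factorial_ne_zero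
  rw [eval_mul, eval_C, eval_comp, eval_sub, eval_X, eval_C, Nat.cast_add, add_sub_cancel_left,
    descPochhammer_eval_eq_descFactorial, Nat.descFactorial_eq_factorial_mul_choose, nsmul_eq_mul,
    Nat.cast_mul]
  field_simp

/-- If the `d`-th difference of `f` is at most its eventual value from `ρ` on, then the differences
of the deviation of `f` from its eventual polynomial have alternating signs from `ρ` on. -/
theorem fwdDiff_iter_sub_alternating {f : ℕ → ℚ} {P : ℚ[X]} {d N ρ : ℕ} {e : ℚ}
    (hP : ∀ n ≥ N, P.eval (n : ℚ) = f n) (hle : ∀ n ≥ ρ, (fwdDiff 1)^[d] f n ≤ e)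
    (heq : ∀ n ≥ N, (fwdDiff 1)^[d] f n = e) {i : ℕ} (hi : i ≤ d) :
    ∀ n ≥ ρ, 0 ≤ (-1 : ℚ) ^ (d - i) *
      (fwdDiff 1)^[i] (fun k : ℕ => P.eval (k : ℚ) - f k) n := by
  have hzero : ∀ i, ∀ n ≥ N, (fwdDiff 1)^[i] (fun k : ℕ => P.eval (k : ℚ) - f k) n = 0 := by
    intro i n hn
    rw [fwdDiff_iter_sub_apply, fwdDiff_iter_congr_of_ge hP i n hn, sub_self]
  induction hi using Nat.decreasingInduction with
  | self =>
    intro n hn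
    obtain ⟨Q, hQ⟩ := exists_polynomial_fwdDiff_iter_eval P d
    -- `ΔᵈP` is a polynomial, so it equals `e` everywhere, including below `N`.
    have hQe : Q.eval (n : ℚ) = e := eval_eq_of_eventually_eq (N := N) (fun m hm => by
      rw [← hQ, fwdDiff_iter_congr_of_ge hP d m hm, heq m hm]) n
    rw [Nat.sub_self, pow_zero, one_mul, fwdDiff_iter_sub_apply, hQ, hQe]
    exact sub_nonneg.2 (hle n hn)
  | of_succ i hi ih =>
    set u := (fwdDiff 1)^[i] (fun k : ℕ => P.eval (k : ℚ) - f k) with hu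
    have hstep : ∀ n ≥ ρ, (-1 : ℚ) ^ (d - i) * u (n + 1) ≤ (-1 : ℚ) ^ (d - i) * u n := by
      intro n hn
      have := ih n hn
      rw [Function.iterate_succ_apply', ← hu, fwdDiff] at this
      rw [show d - i = (d - (i + 1)) + 1 by omega, pow_succ]
      linarith
    intro n hn
    -- The signed `u` is nonincreasing from `ρ` on and eventually zero, hence nonnegative there.
    have hdesc : ∀ k, (-1 : ℚ) ^ (d - i) * u (n + k) ≤ (-1 : ℚ) ^ (d - i) * u n := by
      intro k
      induction k with
      | zero => exact le_rfl
      | succ k ihk => exact (hstep (n + k) (by omega)).trans ihk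
    have := hdesc N
    rwa [hu, hzero i (n + N) (by omega), mul_zero] at this

end ForwardDifference

/-! ### Colength. -/

section Colength

variable {R : Type*} [CommRing R]

/-- The length of `R / J` as a natural number. -/
noncomputable def colength (J : Ideal R) : ℕ :=
  (Module.length R (R ⧸ J)).toNat

theorem length_quotient_anti {J J' : Ideal R} (h : J ≤ J') :
    Module.length R (R ⧸ J') ≤ Module.length R (R ⧸ J) :=
  Module.length_le_of_surjective (Submodule.factor h) (Submodule.factor_surjective h)

theorem colength_anti {J J' : Ideal R} (h : J ≤ J') (hJ : Module.length R (R ⧸ J) ≠ ⊤) :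
    colength J' ≤ colength J :=
  ENat.toNat_le_toNat (length_quotient_anti h) hJ

/-- Additivity on `0 → R/(J : y) → R/J → R/(J + (y)) → 0`, the first map being multiplication by
`y`. -/
theorem length_quotient_eq_add {J C : Ideal R} {y : R} (hC : ∀ a, a ∈ C ↔ y * a ∈ J) :
    Module.length R (R ⧸ J) =
      Module.length R (R ⧸ C) + Module.length R (R ⧸ (J ⊔ Ideal.span {y})) := by
  have hle : C ≤ Submodule.comap (LinearMap.lsmul R R y) J := fun a ha => (hC a).1 ha
  refine Module.length_eq_add_of_exact (Submodule.mapQ C J (LinearMap.lsmul R R y) hle)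
    (Submodule.factor (le_sup_left : J ≤ J ⊔ Ideal.span {y})) ?_
    (Submodule.factor_surjective _) ?_
  · rw [← LinearMap.ker_eq_bot, LinearMap.ker_eq_bot']
    intro a ha
    obtain ⟨a, rfl⟩ := Submodule.mkQ_surjective _ a
    rw [Submodule.mkQ_apply, Submodule.mapQ_apply, Submodule.Quotient.mk_eq_zero] at ha
    rw [Submodule.mkQ_apply, Submodule.Quotient.mk_eq_zero]
    exact (hC a).2 ha
  · intro b
    obtain ⟨b, rfl⟩ := Submodule.mkQ_surjective _ b
    constructor
    · intro hb
      rw [Submodule.factor_mk, Submodule.mkQ_apply, Submodule.Quotient.mk_eq_zero] at hb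
      obtain ⟨k, hk, w, hw, rfl⟩ := Submodule.mem_sup.1 hb
      obtain ⟨c, rfl⟩ := Ideal.mem_span_singleton'.1 hw
      refine ⟨Submodule.Quotient.mk c, ?_⟩
      rw [Submodule.mkQ_apply, Submodule.mapQ_apply, Submodule.Quotient.eq]
      have : LinearMap.lsmul R R y c - (k + c * y) = -k := by
        rw [LinearMap.lsmul_apply, smul_eq_mul]
        ring
      rw [this]
      exact neg_mem hk
    · rintro ⟨c, hc⟩
      obtain ⟨c, rfl⟩ := Submodule.mkQ_surjective _ c
      rw [← hc, Submodule.mkQ_apply, Submodule.mapQ_apply, ← Submodule.mkQ_apply,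
        Submodule.factor_mk, Submodule.mkQ_apply, Submodule.Quotient.mk_eq_zero]
      exact Ideal.mem_sup_right (Ideal.mem_span_singleton'.2 ⟨c, mul_comm _ _⟩)

theorem colength_eq_add {J C : Ideal R} {y : R} (hJ : Module.length R (R ⧸ J) ≠ ⊤)
    (hC : ∀ a, a ∈ C ↔ y * a ∈ J) :
    colength J = colength C + colength (J ⊔ Ideal.span {y}) := by
  have h := length_quotient_eq_add hC
  rw [h] at hJ
  rw [colength, h, ENat.toNat_add (fun h' => hJ (by rw [h', top_add]))
    (fun h' => hJ (by rw [h', add_top])), colength, colength]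

theorem length_quotient_ne_top_of_pow_le [IsNoetherianRing R] [IsLocalRing R] {J : Ideal R} {n : ℕ}
    (h : maximalIdeal R ^ n ≤ J) : Module.length R (R ⧸ J) ≠ ⊤ := by
  rcases eq_or_ne J ⊤ with rfl | hJ
  · have : Subsingleton (R ⧸ (⊤ : Ideal R)) := Ideal.Quotient.subsingleton_iff.2 rfl
    simp [Module.length_eq_zero]
  have : Nontrivial (R ⧸ J) := Ideal.Quotient.nontrivial_iff.2 hJ
  have : IsLocalRing (R ⧸ J) :=
    IsLocalRing.of_surjective' (Ideal.Quotient.mk J) Ideal.Quotient.mk_surjective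
  have : IsLocalHom (Ideal.Quotient.mk J) :=
    IsLocalHom.of_surjective _ Ideal.Quotient.mk_surjective
  have hle : maximalIdeal (R ⧸ J) ≤ (maximalIdeal R).map (Ideal.Quotient.mk J) := by
    intro a ha
    obtain ⟨a, rfl⟩ := Ideal.Quotient.mk_surjective a
    exact Ideal.mem_map_of_mem _ (by simpa using ha)
  have : IsArtinianRing (R ⧸ J) := by
    rw [isArtinianRing_iff_isNilpotent_maximalIdeal]
    refine ⟨n, ?_⟩
    rw [Ideal.zero_eq_bot, eq_bot_iff]
    refine (Ideal.pow_right_mono hle n).trans ?_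
    rw [← Ideal.map_pow, Ideal.map_le_iff_le_comap]
    intro a ha
    simpa [Ideal.Quotient.eq_zero_iff_mem] using h ha
  rw [Module.length_eq_of_surjective (R := R ⧸ J) (S := R) (M := R ⧸ J)
    Ideal.Quotient.mk_surjective]
  exact Module.length_ne_top

theorem length_quotient_ne_top [IsNoetherianRing R] [IsLocalRing R] {I J : Ideal R}
    (hI : I.radical = maximalIdeal R) {n : ℕ} (h : I ^ n ≤ J) : Module.length R (R ⧸ J) ≠ ⊤ := by
  obtain ⟨k, hk⟩ := Ideal.exists_radical_pow_le_of_fg I (IsNoetherian.noetherian _)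
  rw [hI] at hk
  refine length_quotient_ne_top_of_pow_le (n := k * n) (le_trans ?_ h)
  rw [pow_mul]
  exact Ideal.pow_right_mono hk n

end Colength

/-! ### Differences of Hilbert functions as Hilbert functions of quotients. -/

section IteratedQuotients

variable {R : Type*} [CommRing R]

/-- The ideal `(z_0, …, z_{j-1})`. -/
def prefixIdeal (z : ℕ → R) : ℕ → Ideal R
  | 0 => ⊥
  | j + 1 => prefixIdeal z j ⊔ Ideal.span {z j}

/-- If `z_0, …, z_{j-1}` is regular on the graded ring of the filtration `F`, then the `j`-th
difference of the Hilbert function of `F` is the Hilbert function of its image modulo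
`z_0, …, z_{j-1}`. -/
theorem fwdDiff_iter_colength {F : ℕ → Ideal R} {z : ℕ → R}
    (hfin : ∀ n, Module.length R (R ⧸ F n) ≠ ⊤) {t : ℕ}
    (h : ∀ j < t, ∀ n a, a ∈ F n ⊔ prefixIdeal z j ↔ z j * a ∈ F (n + 1) ⊔ prefixIdeal z j)
    {j : ℕ} (hj : j ≤ t) (n : ℕ) :
    (fwdDiff 1)^[j] (fun n => (colength (F n) : ℚ)) n =
      colength (F (n + j) ⊔ prefixIdeal z j) := by
  induction j generalizing n with
  | zero => simp [prefixIdeal]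
  | succ j ih =>
    rw [Function.iterate_succ_apply', fwdDiff, ih (by omega), ih (by omega)]
    have hne : Module.length R (R ⧸ (F (n + j + 1) ⊔ prefixIdeal z j)) ≠ ⊤ :=
      ((length_quotient_anti le_sup_left).trans_lt (hfin _).lt_top).ne
    rw [show n + 1 + j = n + j + 1 by omega, colength_eq_add hne (h j (by omega) (n + j)),
      sup_assoc]
    simp [prefixIdeal, add_assoc]

end IteratedQuotients

/-! ### Superficial sequences in Cohen–Macaulay rings. -/

section CohenMacaulay

variable {R : Type*} [CommRing R]

theorem initialIdeal_zero {s : ℕ} (x : Fin s → R) : initialIdeal x 0 = ⊥ := by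
  simp [initialIdeal]

theorem initialIdeal_succ {s : ℕ} (x : Fin s → R) {i : ℕ} (hi : i < s) :
    initialIdeal x (i + 1) = initialIdeal x i ⊔ Ideal.span {x ⟨i, hi⟩} := by
  rw [initialIdeal, initialIdeal, ← Ideal.span_union]
  congr 1
  ext r
  simp only [Set.mem_ofPred_eq, Set.mem_union, Set.mem_singleton_iff]
  constructor
  · rintro ⟨j, hj, rfl⟩
    rcases Nat.lt_succ_iff_lt_or_eq.1 hj with h | h
    · exact Or.inl ⟨j, h, rfl⟩
    · exact Or.inr (congrArg x (Fin.ext h))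
  · rintro (⟨j, hj, rfl⟩ | rfl)
    · exact ⟨j, by omega, rfl⟩
    · exact ⟨⟨i, hi⟩, Nat.lt_succ_self i, rfl⟩

theorem prefixIdeal_eq_initialIdeal {s : ℕ} {x : Fin s → R} {z : ℕ → R}
    (h : ∀ (i : ℕ) (hi : i < s), z i = x ⟨i, hi⟩) {j : ℕ} (hj : j ≤ s) :
    prefixIdeal z j = initialIdeal x j := by
  induction j with
  | zero => exact (initialIdeal_zero x).symm
  | succ j ih => rw [prefixIdeal, ih (by omega), initialIdeal_succ x hj, h j hj]

variable [IsLocalRing R] [IsNoetherianRing R]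

/-- A superficial sequence of length at most the depth is a regular sequence. -/
theorem isRegularMod_of_isSuperficialMod {I : Ideal R} (hI : I.radical = maximalIdeal R)
    {z : ℕ → R} {d : ℕ} (hd : HasDepthMod d (⊥ : Ideal R))
    (hz : ∀ j < d, z j ∈ I ∧ IsSuperficialMod I (prefixIdeal z j) (z j)) :
    ∀ j < d, IsRegularMod (prefixIdeal z j) (z j) := by
  have hIm : I ≤ maximalIdeal R := hI ▸ Ideal.le_radical
  -- Positive depth puts some regular element in `I`, which forces the superficial `z j` to be
  -- regular too.
  have step : ∀ j, j < d → HasDepthMod (d - j) (prefixIdeal z j) →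
      IsRegularMod (prefixIdeal z j) (z j) := by
    intro j hj h
    rw [show d - j = (d - (j + 1)) + 1 by omega] at h
    obtain ⟨y, hy, hyr⟩ := h.exists_mem_isRegularMod hI
    exact (hz j hj).2.isRegularMod (fun h => (maximalIdeal.isMaximal R).ne_top
      (top_le_iff.1 (h ▸ hIm))) hy hyr
  have depth : ∀ j ≤ d, HasDepthMod (d - j) (prefixIdeal z j) := by
    intro j hj
    induction j with
    | zero => exact hd
    | succ j ih =>
      have h := ih (by omega)
      have hreg := step j hj h
      rw [show d - j = (d - (j + 1)) + 1 by omega] at h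
      exact h.of_isRegularMod (hIm (hz j hj).1) hreg
  exact fun j hj => step j hj (depth j hj.le)

/-- A regular sequence of length `dim R` generates an ideal primary to the maximal ideal. -/
theorem exists_pow_le_prefixIdeal {d : ℕ} (hdim : ringKrullDim R = d) {z : ℕ → R}
    (hz : ∀ j < d, IsRegularMod (prefixIdeal z j) (z j)) :
    ∃ M : ℕ, maximalIdeal R ^ M ≤ prefixIdeal z d := by
  have hle : ∀ j ≤ d, ringKrullDim (R ⧸ prefixIdeal z j) ≤ ((d - j : ℕ) : WithBot ℕ∞) := by
    intro j hj
    induction j with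
    | zero => exact (ringKrullDim_quotient_le _).trans hdim.le
    | succ j ih =>
      have h := (hz j hj).ringKrullDim_succ_le.trans (ih (by omega))
      rw [show d - j = (d - (j + 1)) + 1 by omega, Nat.cast_succ,
        ENat.WithBot.add_le_add_one_right_iff] at h
      exact h
  have h0 : Ring.KrullDimLE 0 (R ⧸ prefixIdeal z d) := by
    rw [Ring.krullDimLE_iff]
    simpa using hle d le_rfl
  have : IsArtinianRing (R ⧸ prefixIdeal z d) := isArtinianRing_iff_krullDimLE_zero.2 h0
  exact exists_maximalIdeal_pow_le_of_isArtinianRing_quotient _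

end CohenMacaulay

/-! ### Depth of the graded ring of the Ratliff–Rush filtration. -/

section RatliffRushDepth

variable {R : Type*} [CommRing R]

theorem mul_mem_ratliffRush_pow_sup {I K : Ideal R} {n : ℕ} {x a : R} (hx : x ∈ I)
    (ha : a ∈ ratliffRush (I ^ n) ⊔ K) : x * a ∈ ratliffRush (I ^ (n + 1)) ⊔ K := by
  obtain ⟨f, hf, k, hk, rfl⟩ := Submodule.mem_sup.1 ha
  rw [mul_add]
  exact add_mem (Ideal.mem_sup_left (mul_mem_ratliffRush_pow_succ hx hf))
    (Ideal.mem_sup_right (Ideal.mul_mem_left _ _ hk))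

/-- If the Ratliff–Rush filtration of `I` behaves well modulo `z_0, …, z_{s-1}`, then
`z_0, …, z_s` is a regular sequence on its associated graded ring. -/
theorem mem_ratliffRush_sup_prefixIdeal_iff {I : Ideal R} {z : ℕ → R} {s : ℕ}
    (hzI : ∀ j ≤ s, z j ∈ I)
    (hstab : ∀ j ≤ s, ∃ N : ℕ, ∀ n ≥ N, ∀ a,
      z j * a ∈ I ^ (n + 1) ⊔ prefixIdeal z j → a ∈ I ^ n ⊔ prefixIdeal z j)
    (hF : ∃ N : ℕ, ∀ n ≥ N, ratliffRush (I ^ n) = I ^ n)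
    (hwell : ∀ n, 1 ≤ n → (ratliffRush (I ^ n)).map (Ideal.Quotient.mk (prefixIdeal z s)) =
      ratliffRush ((I ^ n).map (Ideal.Quotient.mk (prefixIdeal z s)))) {j : ℕ} (hj : j ≤ s) :
    ∀ n a, a ∈ ratliffRush (I ^ n) ⊔ prefixIdeal z j ↔
      z j * a ∈ ratliffRush (I ^ (n + 1)) ⊔ prefixIdeal z j := by
  suffices h : ∀ n a, z j * a ∈ ratliffRush (I ^ (n + 1)) ⊔ prefixIdeal z j →
      a ∈ ratliffRush (I ^ n) ⊔ prefixIdeal z j from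
    fun n a => ⟨mul_mem_ratliffRush_pow_sup (hzI j hj), h n a⟩
  -- Good behaviour settles `j = s`; descent then passes from `z (j + 1)` to `z j`.
  induction hj using Nat.decreasingInduction with
  | self => exact fun n a => mem_ratliffRush_sup_of_mul_mem hwell (hstab s le_rfl)
  | of_succ j hj ih =>
    have h0 : ratliffRush (I ^ 0) ⊔ prefixIdeal z j = ⊤ := by
      rw [ratliffRush_pow_zero, top_sup_eq]
    refine mem_of_mul_mem_of_sup_span (G := fun n => ratliffRush (I ^ n) ⊔ prefixIdeal z j)
      (x := z j) (y := z (j + 1)) h0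
      (fun n a => mul_mem_ratliffRush_pow_sup (hzI j hj.le))
      (fun n a => mul_mem_ratliffRush_pow_sup (hzI (j + 1) hj)) ?_ ?_
    · obtain ⟨N, hN⟩ := hF
      obtain ⟨N', hN'⟩ := hstab j hj.le
      refine ⟨max N N', fun n hn a ha => ?_⟩
      rw [hN n (by omega)]
      rw [hN (n + 1) (by omega)] at ha
      exact hN' n (by omega) a ha
    · intro n a ha
      rw [sup_assoc] at ha ⊢
      exact ih n a ha

end RatliffRushDepth

/-! ### Colength in the one-dimensional quotient. -/

section DimensionOne

variable {R : Type*} [CommRing R]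

/-- Multiplication by a nonzerodivisor `y` modulo `K ≤ G` raises the colength of `G` by the
colength of `K + (y)`. -/
theorem IsRegularMod.colength_span_mul_sup {K G : Ideal R} {y : R} (hy : IsRegularMod K y)
    (hK : K ≤ G) (hfin : Module.length R (R ⧸ (Ideal.span {y} * G ⊔ K)) ≠ ⊤) :
    colength (Ideal.span {y} * G ⊔ K) = colength G + colength (K ⊔ Ideal.span {y}) := by
  -- `(yG + K) : y = G`, since `y` is regular modulo `K ≤ G`.
  rw [colength_eq_add (C := G) (y := y) hfin]
  · congr 2
    refine le_antisymm (sup_le (sup_le (Ideal.mul_le_left.trans le_sup_right) le_sup_left)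
      le_sup_right) (sup_le (le_sup_right.trans le_sup_left) le_sup_right)
  · intro a
    refine ⟨fun ha => Ideal.mem_sup_left
      (Ideal.mul_mem_mul (Ideal.mem_span_singleton_self y) ha), fun ha => ?_⟩
    obtain ⟨w, hw, k, hk, e⟩ := Submodule.mem_sup.1 ha
    obtain ⟨g, hg, rfl⟩ := Ideal.mem_span_singleton_mul.1 hw
    have : a - g ∈ K := hy _ (by
      rw [show y * (a - g) = k by linear_combination -e]
      exact hk)
    rw [show a = (a - g) + g by ring]
    exact add_mem (hK this) hg

end DimensionOne

/-- Eventual stability is needed because `sInf` of the empty set is `0`. -/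
theorem stabilityIndex_spec {R : Type*} [CommRing R] {I : Ideal R}
    (h : ∃ N : ℕ, ∀ n ≥ N, ratliffRush (I ^ n) = I ^ n) :
    ∀ n ≥ stabilityIndex I, ratliffRush (I ^ n) = I ^ n := by
  obtain ⟨N, hN⟩ := h
  exact (Nat.sInf_mem (s := {i : ℕ | 1 ≤ i ∧ ∀ n ≥ i, ratliffRush (I ^ n) = I ^ n})
    ⟨N + 1, by omega, fun n hn => hN n (by omega)⟩).2

/-! ### Extending the sequence and bounding the top difference. -/

section Extension

variable {R : Type*} [CommRing R] [IsLocalRing R] [IsNoetherianRing R]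

/-- A superficial sequence of length `s` extends to a sequence of elements of `I` whose first
`s + 2` terms are superficial. -/
theorem IsSuperficialSequence.exists_extension [Infinite (ResidueField R)] {I : Ideal R}
    (hI : I ≠ ⊤) {s : ℕ} {x : Fin s → R} (hx : IsSuperficialSequence I x) :
    ∃ z : ℕ → R, (∀ (i : ℕ) (hi : i < s), z i = x ⟨i, hi⟩) ∧
      ∀ j < s + 2, z j ∈ I ∧ IsSuperficialMod I (prefixIdeal z j) (z j) := by
  have hle : initialIdeal x s ≤ I := by
    refine Ideal.span_le.2 ?_
    rintro _ ⟨j, -, rfl⟩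
    exact (hx j).1
  obtain ⟨y₁, hy₁, hs₁⟩ := exists_isSuperficialMod I (K := initialIdeal x s)
    (fun h => hI (top_le_iff.1 (h ▸ hle)))
  obtain ⟨y₂, hy₂, hs₂⟩ := exists_isSuperficialMod I (K := initialIdeal x s ⊔ Ideal.span {y₁})
    (fun h => hI (top_le_iff.1
      (h ▸ sup_le hle ((Ideal.span_singleton_le_iff_mem I).2 hy₁))))
  let z : ℕ → R := fun j => if h : j < s then x ⟨j, h⟩ else if j = s then y₁ else y₂
  have hz : ∀ (i : ℕ) (hi : i < s), z i = x ⟨i, hi⟩ := fun i hi => dif_pos hi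
  have hz₁ : z s = y₁ := by simp [z]
  have hz₂ : z (s + 1) = y₂ := by simp [z]
  refine ⟨z, hz, fun j hj => ?_⟩
  rcases lt_trichotomy j s with h | rfl | h
  · rw [prefixIdeal_eq_initialIdeal hz h.le, hz j h]
    exact ⟨(hx ⟨j, h⟩).1, (hx ⟨j, h⟩).2.isSuperficialMod⟩
  · rw [prefixIdeal_eq_initialIdeal hz le_rfl, hz₁]
    exact ⟨hy₁, hs₁⟩
  · obtain rfl : j = s + 1 := by omega
    rw [prefixIdeal, prefixIdeal_eq_initialIdeal hz le_rfl, hz₁, hz₂]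
    exact ⟨hy₂, hs₂⟩

/-- For a Ratliff–Rush filtration which behaves well modulo a superficial sequence of length
`d - 2`, the `d`-th difference of the Hilbert function is bounded by its eventual value. -/
theorem exists_fwdDiff_iter_colength_ratliffRush_le {I : Ideal R}
    (hI : I.radical = maximalIdeal R) {s : ℕ} (hdim : ringKrullDim R = (s + 2 : ℕ))
    {z : ℕ → R} (hzI : ∀ j < s + 2, z j ∈ I)
    (hreg : ∀ j < s + 2, IsRegularMod (prefixIdeal z j) (z j))
    (hstab : ∀ j < s + 2, ∃ N : ℕ, ∀ n ≥ N, ∀ a,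
      z j * a ∈ I ^ (n + 1) ⊔ prefixIdeal z j → a ∈ I ^ n ⊔ prefixIdeal z j)
    (hF : ∃ N : ℕ, ∀ n ≥ N, ratliffRush (I ^ n) = I ^ n)
    (hwell : ∀ n, 1 ≤ n → (ratliffRush (I ^ n)).map (Ideal.Quotient.mk (prefixIdeal z s)) =
      ratliffRush ((I ^ n).map (Ideal.Quotient.mk (prefixIdeal z s)))) :
    ∃ (e : ℚ) (N : ℕ),
      (∀ n, (fwdDiff 1)^[s + 2] (fun n => (colength (ratliffRush (I ^ n)) : ℚ)) n ≤ e) ∧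
      ∀ n ≥ N, (fwdDiff 1)^[s + 2] (fun n => (colength (ratliffRush (I ^ n)) : ℚ)) n = e := by
  set K := prefixIdeal z (s + 1) with hKdef
  set y := z (s + 1) with hydef
  set G : ℕ → Ideal R := fun n => ratliffRush (I ^ n) ⊔ K with hG
  have hdiff : ∀ n, (fwdDiff 1)^[s + 2] (fun n => (colength (ratliffRush (I ^ n)) : ℚ)) n =
      colength (G (n + (s + 1) + 1)) - colength (G (n + (s + 1))) := by
    intro n
    have h := fwdDiff_iter_colength (F := fun n => ratliffRush (I ^ n)) (z := z) (t := s + 1)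
      (fun n => length_quotient_ne_top hI (pow_le_ratliffRush I n))
      (fun j hj => mem_ratliffRush_sup_prefixIdeal_iff (fun i hi => hzI i (by omega))
        (fun i hi => hstab i (by omega)) hF hwell (by omega)) le_rfl
    rw [Function.iterate_succ_apply', fwdDiff, h, h, show n + 1 + (s + 1) = n + (s + 1) + 1 by omega]
  have hmul : ∀ n, Ideal.span {y} * G n ⊔ K ≤ G (n + 1) := by
    refine fun n => sup_le (Ideal.span_singleton_mul_le_iff.2 fun a ha => ?_) le_sup_right
    exact mul_mem_ratliffRush_pow_sup (hzI (s + 1) (by omega)) ha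
  have hred : ∃ N : ℕ, ∀ n ≥ N, I ^ (n + 1) ≤ Ideal.span {y} * G n ⊔ K := by
    obtain ⟨M, hM⟩ := exists_pow_le_prefixIdeal hdim hreg
    have hIM : I ^ M ≤ K ⊔ Ideal.span {y} :=
      (Ideal.pow_right_mono (hI ▸ Ideal.le_radical) M).trans hM
    obtain ⟨N, hN⟩ := exists_forall_pow_succ_le (hstab (s + 1) (by omega)) hIM
    refine ⟨N, fun n hn => (hN n hn).trans (sup_le_sup_right (Ideal.mul_mono_right ?_) _)⟩
    exact sup_le_sup_right (pow_le_ratliffRush I n) K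
  obtain ⟨N, hN⟩ := hred
  have hanti : ∀ n k, G (n + k) ≤ G n := by
    refine fun n k => sup_le_sup_right (fun a ha => ?_) K
    rw [mem_ratliffRush_pow_iff] at ha ⊢
    obtain ⟨l, hl⟩ := ha
    exact ⟨l, fun b hb => Ideal.pow_le_pow_right (by omega) (hl b hb)⟩
  -- The reduction property holds only from `N` on, but `G (n + N) ≤ G n` gives a power of `I`
  -- inside for every `n`.
  have hfin : ∀ n, Module.length R (R ⧸ (Ideal.span {y} * G n ⊔ K)) ≠ ⊤ := by
    refine fun n => length_quotient_ne_top hI (n := n + N + 1) ((hN _ (by omega)).trans ?_)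
    exact sup_le_sup_right (Ideal.mul_mono_right (hanti n N)) K
  have hstep : ∀ n, (colength (Ideal.span {y} * G n ⊔ K) : ℚ) =
      colength (G n) + colength (K ⊔ Ideal.span {y}) := by
    intro n
    exact_mod_cast (hreg (s + 1) (by omega)).colength_span_mul_sup le_sup_right (hfin n)
  obtain ⟨N', hN'⟩ := hF
  refine ⟨colength (K ⊔ Ideal.span {y}), max N N', fun n => ?_, fun n hn => ?_⟩
  · rw [hdiff, sub_le_iff_le_add', ← hstep]
    exact_mod_cast colength_anti (hmul _) (hfin _)
  · rw [hdiff, sub_eq_iff_eq_add', ← hstep]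
    congr 2
    refine le_antisymm (sup_le ?_ le_sup_right) (hmul _)
    rw [hN' _ (by omega)]
    exact hN _ (by omega)

end Extension

/-! ### The main theorem. -/

theorem theorem5p6 {R : Type*} [CommRing R] [IsLocalRing R]
    [Infinite (ResidueField R)] (hR : IsCohenMacaulayLocal R)
    (d : ℕ) (hd : 2 ≤ d) (hdim : ringKrullDim R = d)
    (I : Ideal R) (hI : I.radical = maximalIdeal R)
    (x : Fin (d - 2) → R) (hx : IsSuperficialSequence I x)
    (hwell : RatliffRushBehavesWell I x) :
    IsHilbertSamuelPoly I (hilbertSamuelPoly I) ∧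
      ∀ i : ℕ, i ≤ d → ∀ n : ℕ, stabilityIndex I ≤ n →
        0 ≤ (-1 : ℚ) ^ (d - i) *
          (fwdDiff 1)^[i]
            (fun k : ℕ => (hilbertSamuelPoly I).eval (k : ℚ) - (hilbertSamuel I k : ℚ)) n := by
  have := hR.1
  obtain ⟨s, rfl⟩ := Nat.exists_eq_add_of_le' hd
  change Fin s → R at x
  have hItop : I ≠ ⊤ := by
    rintro rfl
    exact (maximalIdeal.isMaximal R).ne_top (by rw [← hI, Ideal.radical_top])
  obtain ⟨z, hzx, hz⟩ := IsSuperficialSequence.exists_extension (s := s) hItop hx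
  have hreg := isRegularMod_of_isSuperficialMod hI (hR.hasDepthMod hdim) hz
  have hstab := fun j hj => (hz j hj).2.exists_forall_mem_pow_sup (hreg j hj)
  have hF : ∃ N : ℕ, ∀ n ≥ N, ratliffRush (I ^ n) = I ^ n := by
    obtain ⟨N, hN⟩ := hstab 0 (by omega)
    simp only [prefixIdeal, sup_bot_eq] at hN
    exact ⟨N, fun n hn => ratliffRush_pow_eq_of_isSuperficial (hz 0 (by omega)).1 hN hn⟩
  have hwell' : ∀ n, 1 ≤ n → (ratliffRush (I ^ n)).map (Ideal.Quotient.mk (prefixIdeal z s)) =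
      ratliffRush ((I ^ n).map (Ideal.Quotient.mk (prefixIdeal z s))) := by
    rw [prefixIdeal_eq_initialIdeal hzx le_rfl]
    exact hwell
  obtain ⟨e, N, hle, heq⟩ := exists_fwdDiff_iter_colength_ratliffRush_le hI hdim
    (fun j hj => (hz j hj).1) hreg hstab hF hwell'
  have hstable := stabilityIndex_spec hF
  -- Forward differences at `n` only see values at indices `≥ n`, so from the stability index on
  -- `Iⁿ` may be replaced by its closure.
  have hcongr := fwdDiff_iter_congr_of_ge (f := fun n => (hilbertSamuel I n : ℚ))
    (g := fun n => (colength (ratliffRush (I ^ n)) : ℚ)) (N := stabilityIndex I)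
    (fun n hn => by rw [hstable n hn]; rfl) (s + 2)
  have heq' : ∀ n ≥ max N (stabilityIndex I),
      (fwdDiff 1)^[s + 2] (fun n => (hilbertSamuel I n : ℚ)) n = e := fun n hn => by
    rw [hcongr n (by omega), heq n (by omega)]
  obtain ⟨P, hP⟩ := exists_polynomial_of_fwdDiff_iter_eq heq'
  have hHS : IsHilbertSamuelPoly I P := eventually_atTop.2 ⟨_, hP⟩
  rw [hHS.eq]
  exact ⟨hHS, fun i hi => fwdDiff_iter_sub_alternating hP
    (fun n hn => (hcongr n hn).trans_le (hle n)) heq' hi⟩
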